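/- Let $0<q<1$ and $\kappa\in\mathbf{i}\mathbb{R}_{>0}$ with $|\kappa|\notin\{q^{m/2}: m\in\mathbb{Z}\}$. Put $(a;q)_k=\prod_{j=0}^{k-1}(1-aq^j)$, $(a;q)_\infty=\prod_{j\ge 0}(1-aq^j)$ and $\theta_q(z)=(z;q)_\infty(q/z;q)_\infty$. For $n\in\frac12\mathbb{Z}_{\ge0}$ and $x\in\frac12\mathbb{Z}$ define $$\mathcal{F}_n(x)=\sqrt{1-\kappa^{-2}q^{-2x}}\sum_{i=-n}^{n}\frac{(-1)^{n+i}q^{-i/2}}{(q;q)_{n-i}(q;q)_{n+i}}\,\frac{1}{\theta_{\sqrt q}\bigl(|\kappa|q^{x+i+\frac12}\bigr)},$$ where $i$ runs over $-n,-n+1,\dots,n$. Then for all $x,y\in\frac12\mathbb{Z}$ with $x-y\in\mathbb{Z}$, $$\sum_{n\in\frac12\mathbb{Z}_{\ge0}}\frac{\mathcal{F}_n(x)\,\mathcal{F}_n(y)}{\|\mathcal{F}_n\|^2_{\ell^2(\mathbb{Z})}}=\mathbf{1}_{x=y},$$ where the series converges absolutely. The functions $\mathcal{F}_n/\|\mathcal{F}_n\|_{\ell^2(\mathbb{Z})}$,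 $n\in\frac12\mathbb{Z}_{\ge0}$, are orthonormal and complete (their finite linear combinations are dense) in each of the spaces $\ell^2(\mathbb{Z})$ and $\ell^2(\mathbb{Z}+\frac12)$. They also belong to $\ell^2(\frac12\mathbb{Z})$, but are not complete there. The $\ell^2$ spaces may be taken over $\mathbb{R}$ or over $\mathbb{C}$. -/

import Mathlib

noncomputable section

namespace BarcodeF

/-- The finite `q`-Pochhammer symbol `(a;q)_k = (1 - a)(1 - a q) ⋯ (1 - a q ^ (k - 1))`. -/
def qPoch (a q : ℝ) (k : ℕ) : ℝ := ∏ j ∈ Finset.range k, (1 - a * q ^ j)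

/-- The infinite `q`-Pochhammer symbol `(a;q)_∞` (the product converges for `|q| < 1`). -/
def qPochInf (a q : ℝ) : ℝ := ∏' j : ℕ, (1 - a * q ^ j)

/-- The Jacobi theta function `θ_q(z) = (z;q)_∞ (q/z;q)_∞`. -/
def theta (q z : ℝ) : ℝ := qPochInf z q * qPochInf (q / z) q

/-- The function `𝓕_n(x)` for `n = N / 2`, where `N = 0, 1, 2, …`.
The summation index `i ∈ {-n, -n + 1, …, n}` is encoded by the pair
`(a, b) = (n - i, n + i)` of natural numbers with `a + b = N`, so that `i = (b - a) / 2`.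
For `κ` on the imaginary axis the quantity under the square root is real, and taking its real
part only changes its type. -/
def F (q : ℝ) (κ : ℂ) (N : ℕ) (x : ℝ) : ℝ :=
  Real.sqrt ((1 - κ ^ (-2 : ℤ) * ((q ^ (-2 * x) : ℝ) : ℂ)).re) *
    ∑ p ∈ Finset.HasAntidiagonal.antidiagonal N,
      ((-1) ^ p.2 * q ^ (-(((p.2 : ℝ) - (p.1 : ℝ)) / 2) / 2)) / (qPoch q q p.1 * qPoch q q p.2) *
        (1 / theta (Real.sqrt q) (‖κ‖ * q ^ (x + ((p.2 : ℝ) - (p.1 : ℝ)) / 2 + 1 / 2)))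

/-- The integers `ℤ`, as a set of real numbers. -/
def integers : Set ℝ := {x | ∃ m : ℤ, x = m}

/-- The shifted lattice `ℤ' = ℤ + 1/2`. -/
def shiftedIntegers : Set ℝ := {x | ∃ m : ℤ, x = m + 1 / 2}

/-- The lattice `½ℤ`. -/
def halfIntegers : Set ℝ := {x | ∃ m : ℤ, x = m / 2}

/-- The norm in `ℓ²(S)` of (the restriction to `S` of) a function `f`. -/
def l2Norm (S : Set ℝ) (f : ℝ → ℝ) : ℝ := Real.sqrt (∑' x : S, f x ^ 2)

/-- The normalized function `𝓕_n / ‖𝓕_n‖_{ℓ²(ℤ)}`, `n = N / 2`. -/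
def normalizedF (q : ℝ) (κ : ℂ) (N : ℕ) (x : ℝ) : ℝ :=
  F q κ N x / l2Norm integers (F q κ N)

/-- The Hilbert space `ℓ²(S)` with real or complex scalars. -/
abbrev L2 (𝕜 : Type*) [RCLike 𝕜] (S : Set ℝ) : Type _ := lp (fun _ : S => 𝕜) 2

/-- A family of vectors is complete if its finite linear combinations are dense. -/
def IsCompleteSystem (𝕜 : Type*) [RCLike 𝕜] {H : Type*} [NormedAddCommGroup H]
    [InnerProductSpace 𝕜 H] {ι : Type*} (e : ι → H) : Prop :=
  (Submodule.span 𝕜 (Set.range e)).topologicalClosure = ⊤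

end BarcodeF

end

open Filter Topology

namespace BarcodeF

/-! Write `q = t ^ 4`, `k = ‖κ‖`, `x = X / 2`. Quasi-periodicity of the theta function turns each `1
/ θ` into a monomial over the constant `θ(k)`. Hence `𝓕_n(x)` is, up to a nonzero factor and the
sign `(-1) ^ X`, the square root of a weight times a `q⁻¹`-Hermite polynomial `h_N` at the node `k t
^ (2X)` (`F_half_eq`).

Orthogonality holds on each coset of `ℤ` separately. For `N ≥ 1` the weight times `h_N` is a
difference along the coset, so it sums to zero; for `N = 0` the sum is the same theta series on both
cosets (`hasSum_weight_mul_qInvHermite`). The three-term recurrence then gives all products. Both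
cosets thus solve one moment problem, which is therefore indeterminate, and completeness needs its
own argument.

For completeness, the Christoffel–Darboux formula writes the partial sums of the kernel at two nodes
of one coset as a Wronskian. Bessel's inequality gives `t ^ N h_N → 0` at every node. Two steps
along the lattice multiply `h_N` by a constant independent of `N`, up to an error `o(t ^ N)`; so the
Wronskian tends to zero (`tendsto_sum_qInvHermite`). Vanishing of the kernel off the diagonal puts
every point mass in the closed span (`isCompleteSystem_of_tendsto`), and Parseval gives the
identity.

On `½ℤ` both cosets contribute, so the squared norms double while the kernel on the diagonal stays
`1`; this contradicts Parseval. -/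

theorem hasSum_of_eq {ι : Type*} {f g : ι → ℝ} {a b : ℝ} (h : HasSum g b)
    (hf : ∀ x, f x = g x) (ha : a = b) : HasSum f a := by
  rw [ha, funext hf]
  exact h

/-! ### Shift relations and recurrence of the `q⁻¹`-Hermite polynomials. -/

theorem qPoch_zero (a q : ℝ) : qPoch a q 0 = 1 := by simp [qPoch]

theorem qPoch_self_succ (q : ℝ) (n : ℕ) :
    qPoch q q (n + 1) = qPoch q q n * (1 - q ^ (n + 1)) := by
  simp only [qPoch, Finset.prod_range_succ, pow_succ']

theorem qPoch_self_pos {q : ℝ} (hq0 : 0 < q) (hq1 : q < 1) (n : ℕ) : 0 < qPoch q q n := by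
  induction n with
  | zero => simp [qPoch_zero]
  | succ n ih =>
    rw [qPoch_self_succ]
    exact mul_pos ih (sub_pos.2 (pow_lt_one₀ hq0.le hq1 (by simp)))

/-- A Laurent polynomial in `z`; as a function of `z - 1 / z` it is a multiple of the continuous
`q⁻¹`-Hermite polynomial of degree `N`, where `q = t ^ 4`. -/
noncomputable def qInvHermite (t : ℝ) (N : ℕ) (z : ℝ) : ℝ :=
  ∑ p ∈ Finset.HasAntidiagonal.antidiagonal N,
    (-1) ^ p.1 * z ^ ((p.2 : ℤ) - p.1) * t ^ (((p.2 : ℤ) - p.1) ^ 2) /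
      (qPoch (t ^ 4) (t ^ 4) p.1 * qPoch (t ^ 4) (t ^ 4) p.2)

theorem qInvHermite_zero (t z : ℝ) : qInvHermite t 0 z = 1 := by
  simp [qInvHermite, qPoch_zero]


theorem qPoch_pow_four_pos {t : ℝ} (ht0 : 0 < t) (ht1 : t < 1) (n : ℕ) :
    0 < qPoch (t ^ 4) (t ^ 4) n :=
  qPoch_self_pos (by positivity) (pow_lt_one₀ ht0.le ht1 (by simp)) n

theorem one_sub_pow_four_pos {t : ℝ} (ht0 : 0 < t) (ht1 : t < 1) (n : ℕ) :
    0 < 1 - (t ^ 4) ^ (n + 1) :=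
  sub_pos.2 (pow_lt_one₀ (by positivity) (pow_lt_one₀ ht0.le ht1 (by simp)) (by simp))

/-- Exchanging the two summation indices proves this symmetry. It turns every relation for the shift
`z ↦ z t ^ 2` into one for the inverse shift. -/
theorem qInvHermite_neg_inv (t : ℝ) (N : ℕ) (z : ℝ) :
    qInvHermite t N (-z⁻¹) = qInvHermite t N z := by
  simp only [qInvHermite]
  rw [← Finset.Nat.sum_antidiagonal_swap]
  refine Finset.sum_congr rfl fun p _ => ?_
  have e : (-1 : ℝ) ^ p.2 * (-z⁻¹) ^ ((p.1 : ℤ) - p.2) =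
      (-1) ^ p.1 * z ^ ((p.2 : ℤ) - p.1) := by
    rw [neg_eq_neg_one_mul z⁻¹, mul_zpow, inv_zpow', neg_sub, zpow_sub₀ (by norm_num),
      zpow_natCast, zpow_natCast]
    rcases neg_one_pow_eq_or ℝ p.2 with h | h <;> rw [h] <;> ring
  simp only [Prod.fst_swap, Prod.snd_swap]
  rw [e, mul_comm (qPoch _ _ p.2), sub_sq_comm]

/-- The combination on the left multiplies each term by `1 - q ^ p.2`, which kills `p.2 = 0` and
otherwise cancels the last factor of a Pochhammer symbol, lowering the degree. -/
theorem qInvHermite_succ_sub {t : ℝ} (ht0 : 0 < t) (ht1 : t < 1) (N : ℕ) {z : ℝ} (hz : z ≠ 0) :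
    qInvHermite t (N + 1) z - t ^ (2 * (N + 1)) * qInvHermite t (N + 1) (z * t ^ 2) =
      z * t * qInvHermite t N (z * t ^ 2) := by
  have key : qInvHermite t (N + 1) z - t ^ (2 * (N + 1)) * qInvHermite t (N + 1) (z * t ^ 2) =
      ∑ p ∈ Finset.HasAntidiagonal.antidiagonal (N + 1), (1 - (t ^ 4) ^ p.2) *
        ((-1) ^ p.1 * z ^ ((p.2 : ℤ) - p.1) * t ^ (((p.2 : ℤ) - p.1) ^ 2) /
        (qPoch (t ^ 4) (t ^ 4) p.1 * qPoch (t ^ 4) (t ^ 4) p.2)) := by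
    simp only [qInvHermite, Finset.mul_sum, ← Finset.sum_sub_distrib]
    refine Finset.sum_congr rfl fun p hp => ?_
    have hN : p.1 + p.2 = N + 1 := by simpa using hp
    have e : t ^ (2 * (N + 1)) * (t ^ 2) ^ ((p.2 : ℤ) - p.1) = (t ^ 4) ^ p.2 := by
      simp only [← hN, ← zpow_natCast, ← zpow_mul, ← zpow_add₀ ht0.ne']
      congr 1
      push_cast
      ring
    rw [mul_zpow, ← e]
    ring
  rw [key, Finset.Nat.sum_antidiagonal_succ']
  simp only [pow_zero, sub_self, zero_mul, zero_add, qInvHermite, Finset.mul_sum]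
  refine Finset.sum_congr rfl fun p _ => ?_
  have h1 := (qPoch_pow_four_pos ht0 ht1 p.1).ne'
  have h2 := (qPoch_pow_four_pos ht0 ht1 p.2).ne'
  have h3 := (one_sub_pow_four_pos ht0 ht1 p.2).ne'
  have ez : z ^ (((p.2 + 1 : ℕ) : ℤ) - p.1) = z * z ^ ((p.2 : ℤ) - p.1) := by
    rw [← zpow_one_add₀ hz]
    congr 1
    push_cast
    ring
  have et : t ^ ((((p.2 + 1 : ℕ) : ℤ) - p.1) ^ 2) =
      t * (t ^ 2) ^ ((p.2 : ℤ) - p.1) * t ^ (((p.2 : ℤ) - p.1) ^ 2) := by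
    rw [← zpow_natCast t 2, ← zpow_mul, ← zpow_one_add₀ ht0.ne', ← zpow_add₀ ht0.ne']
    congr 1
    push_cast
    ring
  rw [qPoch_self_succ, ez, et, mul_zpow]
  field_simp

theorem qInvHermite_mul_sq {t : ℝ} (ht0 : 0 < t) (ht1 : t < 1) (N : ℕ) {z : ℝ} (hz : z ≠ 0) :
    qInvHermite t (N + 1) (z * t ^ 2) =
      t ^ (2 * (N + 1)) * qInvHermite t (N + 1) z - z⁻¹ * t⁻¹ * qInvHermite t N z := by
  -- At this argument the symmetry exchanges the roles of `z` and `z * t ^ 2`.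
  have h := qInvHermite_succ_sub ht0 ht1 N (z := -(z * t ^ 2)⁻¹)
    (neg_ne_zero.2 (inv_ne_zero (by positivity)))
  have e : -(z * t ^ 2)⁻¹ * t ^ 2 = -z⁻¹ := by field_simp
  rw [e, qInvHermite_neg_inv, qInvHermite_neg_inv, qInvHermite_neg_inv] at h
  have e2 : -(z * t ^ 2)⁻¹ * t = -(z⁻¹ * t⁻¹) := by field_simp
  rw [e2] at h
  linear_combination h

theorem qInvHermite_succ_mul_sq {t : ℝ} (ht0 : 0 < t) (ht1 : t < 1) (N : ℕ) {z : ℝ}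
    (hz : z ≠ 0) :
    (1 - (t ^ 4) ^ (N + 1)) * qInvHermite t (N + 1) z =
      z * t * qInvHermite t N (z * t ^ 2) - t ^ (2 * N + 1) * z⁻¹ * qInvHermite t N z := by
  have h1 := qInvHermite_succ_sub ht0 ht1 N hz
  rw [qInvHermite_mul_sq ht0 ht1 N hz] at h1
  have e : t ^ (2 * (N + 1)) * t⁻¹ = t ^ (2 * N + 1) := by
    field_simp
    ring
  rw [← h1, ← e]
  ring

theorem qInvHermite_succ_div_sq {t : ℝ} (ht0 : 0 < t) (ht1 : t < 1) (N : ℕ) {z : ℝ}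
    (hz : z ≠ 0) :
    (1 - (t ^ 4) ^ (N + 1)) * qInvHermite t (N + 1) z =
      t ^ (2 * N + 1) * z * qInvHermite t N z - z⁻¹ * t * qInvHermite t N (z / t ^ 2) := by
  have h := qInvHermite_succ_mul_sq ht0 ht1 N (z := -z⁻¹) (neg_ne_zero.2 (inv_ne_zero hz))
  have e : -z⁻¹ * t ^ 2 = -(z / t ^ 2)⁻¹ := by field_simp
  rw [e, qInvHermite_neg_inv, qInvHermite_neg_inv, qInvHermite_neg_inv, inv_neg, inv_inv] at h
  rw [h]
  ring

/-- In the combination `z * h1 + z⁻¹ * h2` the unshifted terms cancel. What remains becomes a pure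
difference once multiplied by the weight. -/
theorem qInvHermite_raising {t : ℝ} (ht0 : 0 < t) (ht1 : t < 1) (N : ℕ) {z : ℝ} (hz : z ≠ 0) :
    (1 - (t ^ 4) ^ (N + 1)) * ((z + z⁻¹) * qInvHermite t (N + 1) z) =
      t * (z ^ 2 * qInvHermite t N (z * t ^ 2) - (z ^ 2)⁻¹ * qInvHermite t N (z / t ^ 2)) := by
  have h1 := qInvHermite_succ_mul_sq ht0 ht1 N hz
  have h2 := qInvHermite_succ_div_sq ht0 ht1 N hz
  rw [← inv_pow]
  linear_combination z * h1 + z⁻¹ * h2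

theorem qInvHermite_one {t : ℝ} (ht0 : 0 < t) (ht1 : t < 1) {z : ℝ} (hz : z ≠ 0) :
    (1 - t ^ 4) * qInvHermite t 1 z = t * (z - z⁻¹) := by
  have h := qInvHermite_succ_mul_sq ht0 ht1 0 hz
  simp only [qInvHermite_zero, zero_add, pow_one] at h
  rw [h]
  ring

theorem qInvHermite_three_term {t : ℝ} (ht0 : 0 < t) (ht1 : t < 1) (N : ℕ) {z : ℝ}
    (hz : z ≠ 0) :
    (1 - (t ^ 4) ^ (N + 2)) * qInvHermite t (N + 2) z + qInvHermite t N z =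
      t ^ (2 * N + 3) * (z - z⁻¹) * qInvHermite t (N + 1) z := by
  have h1 := qInvHermite_succ_mul_sq ht0 ht1 (N + 1) hz
  rw [qInvHermite_mul_sq ht0 ht1 N hz] at h1
  rw [h1]
  field_simp
  ring

theorem christoffel_darboux {t : ℝ} (ht0 : 0 < t) (ht1 : t < 1) (N : ℕ) {z w : ℝ}
    (hz : z ≠ 0) (hw : w ≠ 0) :
    t * ((z - z⁻¹) - (w - w⁻¹)) * ∑ n ∈ Finset.range (N + 1),
        qPoch (t ^ 4) (t ^ 4) n * t ^ (2 * n) * (qInvHermite t n z * qInvHermite t n w) =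
      qPoch (t ^ 4) (t ^ 4) (N + 1) * (qInvHermite t (N + 1) z * qInvHermite t N w -
        qInvHermite t N z * qInvHermite t (N + 1) w) := by
  induction N with
  | zero =>
    simp only [zero_add, Finset.range_one, Finset.sum_singleton, qPoch_zero, qInvHermite_zero,
      qPoch_self_succ, pow_one, mul_zero, pow_zero]
    linear_combination -qInvHermite_one ht0 ht1 hz + qInvHermite_one ht0 ht1 hw
  | succ N ih =>
    rw [Finset.sum_range_succ, mul_add, ih, qPoch_self_succ _ (N + 1)]
    have h1 := qInvHermite_three_term ht0 ht1 N hz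
    have h2 := qInvHermite_three_term ht0 ht1 N hw
    linear_combination qPoch (t ^ 4) (t ^ 4) (N + 1) *
      (qInvHermite t (N + 1) z * h2 - qInvHermite t (N + 1) w * h1)

/-! ### Orthogonality on the sublattices of step two. -/

section Lattice

/-- The point of the lattice `k t ^ (2ℤ)` with index `X`. -/
noncomputable def node (t k : ℝ) (X : ℤ) : ℝ := k * t ^ (2 * X)

/-- The terms of the theta series that gives the total mass. -/
noncomputable def massTerm (t k : ℝ) (X : ℤ) : ℝ := k ^ (2 * X) * t ^ (2 * X * (X + 1))

/-- The weight of the `q⁻¹`-Hermite polynomials at a lattice point. -/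
noncomputable def weight (t k : ℝ) (X : ℤ) : ℝ := massTerm t k X * (1 + (node t k X ^ 2)⁻¹)

variable {t k : ℝ}

theorem node_pos (ht0 : 0 < t) (hk : 0 < k) (X : ℤ) : 0 < node t k X := by
  unfold node; positivity

theorem massTerm_pos (ht0 : 0 < t) (hk : 0 < k) (X : ℤ) : 0 < massTerm t k X := by
  unfold massTerm; positivity

theorem weight_pos (ht0 : 0 < t) (hk : 0 < k) (X : ℤ) : 0 < weight t k X := by
  have h1 := node_pos ht0 hk X
  have h2 := massTerm_pos ht0 hk X
  unfold weight
  positivity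

theorem node_add_one (ht0 : 0 < t) (X : ℤ) : node t k (X + 1) = node t k X * t ^ 2 := by
  rw [node, node, mul_assoc, ← zpow_natCast t 2, ← zpow_add₀ ht0.ne']
  congr 2
  push_cast
  ring

theorem node_sub_one (ht0 : 0 < t) (X : ℤ) : node t k (X - 1) = node t k X / t ^ 2 := by
  rw [eq_div_iff (by positivity), ← node_add_one ht0, sub_add_cancel]

theorem massTerm_sub_one (ht0 : 0 < t) (hk : 0 < k) (X : ℤ) :
    massTerm t k (X - 1) = massTerm t k X * (node t k X ^ 2)⁻¹ := by
  have h := (node_pos ht0 hk X).ne'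
  rw [eq_mul_inv_iff_mul_eq₀ (by positivity)]
  rw [massTerm, massTerm, node, mul_pow, ← zpow_natCast, ← zpow_natCast, ← zpow_mul,
    mul_mul_mul_comm, ← zpow_add₀ hk.ne', ← zpow_add₀ ht0.ne']
  congr 2 <;> push_cast <;> ring

theorem massTerm_add_one (ht0 : 0 < t) (hk : 0 < k) (X : ℤ) :
    massTerm t k (X + 1) = massTerm t k X * (node t k X ^ 2 * t ^ 4) := by
  have h := massTerm_sub_one ht0 hk (X + 1)
  have hn := (node_pos ht0 hk X).ne'
  rw [add_sub_cancel_right, node_add_one ht0] at h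
  rw [h]
  field_simp

theorem weight_eq_add (ht0 : 0 < t) (hk : 0 < k) (X : ℤ) :
    weight t k X = massTerm t k X + massTerm t k (X - 1) := by
  rw [massTerm_sub_one ht0 hk, weight]
  ring

theorem summable_zpow_mul_zpow_sq (ht0 : 0 < t) (ht1 : t < 1) {c : ℝ} (hc : 0 < c) :
    Summable fun X : ℤ => c ^ X * t ^ (2 * X ^ 2) := by
  have hlog : Real.log t < 0 := Real.log_neg ht0 ht1
  have hpi := Real.pi_pos
  -- Imaginary parameters for which the Jacobi theta term has norm `c ^ X * t ^ (2 * X ^ 2)`.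
  let z : ℂ := ⟨0, -Real.log c / (2 * Real.pi)⟩
  let τ : ℂ := ⟨0, -2 * Real.log t / Real.pi⟩
  have hτ : 0 < τ.im := div_pos (by linarith) hpi
  refine ((summable_jacobiTheta₂_term_iff z τ).2 hτ).norm.congr fun X => ?_
  rw [norm_jacobiTheta₂_term]
  have e : -Real.pi * (X : ℝ) ^ 2 * τ.im - 2 * Real.pi * X * z.im =
      Real.log c * X + Real.log t * ((2 * X ^ 2 : ℤ) : ℝ) := by
    simp only [z, τ]
    push_cast
    field_simp
    ring
  rw [e, Real.exp_add, ← Real.rpow_def_of_pos hc, ← Real.rpow_def_of_pos ht0, Real.rpow_intCast,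
    Real.rpow_intCast]

/-- Functions whose product with any power of the lattice variable is summable against
`massTerm`. -/
def RapidlySummable (t k : ℝ) (f : ℤ → ℝ) : Prop :=
  ∀ j : ℤ, Summable fun X => massTerm t k X * node t k X ^ j * f X

theorem rapidlySummable_one (ht0 : 0 < t) (ht1 : t < 1) (hk : 0 < k) :
    RapidlySummable t k fun _ => 1 := fun j => by
  have h := (summable_zpow_mul_zpow_sq ht0 ht1
    (c := k ^ 2 * t ^ (2 * j + 2)) (by positivity)).mul_left (k ^ j)
  refine h.congr fun X => ?_
  simp only [massTerm, node, mul_zpow, ← zpow_natCast, ← zpow_mul]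
  rw [show (2 * X * (X + 1) : ℤ) = 2 * X ^ 2 + 2 * X by ring, zpow_add₀ ht0.ne',
    show (2 * j + 2) * X = 2 * X + 2 * X * j by ring, zpow_add₀ ht0.ne']
  push_cast
  ring

theorem RapidlySummable.mul_qInvHermite (ht0 : 0 < t) (hk : 0 < k) {f : ℤ → ℝ}
    (hf : RapidlySummable t k f) (N : ℕ) :
    RapidlySummable t k fun X => f X * qInvHermite t N (node t k X) := fun j => by
  simp only [qInvHermite, Finset.mul_sum]
  refine summable_sum fun p _ => ?_
  refine ((hf (j + ((p.2 : ℤ) - p.1))).mul_left ((-1) ^ p.1 * t ^ (((p.2 : ℤ) - p.1) ^ 2) /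
      (qPoch (t ^ 4) (t ^ 4) p.1 * qPoch (t ^ 4) (t ^ 4) p.2))).congr fun X => ?_
  rw [zpow_add₀ (node_pos ht0 hk X).ne']
  ring

theorem lattice_injective (p : ℤ) : Function.Injective fun m : ℤ => 2 * m + p :=
  fun a b h => by simpa using h

/-- The total mass. -/
noncomputable def mass (t k : ℝ) : ℝ := ∑' X, massTerm t k X

theorem hasSum_massTerm (ht0 : 0 < t) (ht1 : t < 1) (hk : 0 < k) :
    HasSum (massTerm t k) (mass t k) := by
  have := rapidlySummable_one ht0 ht1 hk 0
  simp only [zpow_zero, mul_one] at this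
  exact this.hasSum

theorem mass_pos (ht0 : 0 < t) (ht1 : t < 1) (hk : 0 < k) : 0 < mass t k :=
  (massTerm_pos ht0 hk 0).trans_le
    (le_hasSum (hasSum_massTerm ht0 ht1 hk) 0 fun X _ => (massTerm_pos ht0 hk X).le)

theorem hasSum_of_sublattices {f : ℤ → ℝ} {a b : ℝ} {p : ℤ}
    (ha : HasSum (fun m : ℤ => f (2 * m + p)) a)
    (hb : HasSum (fun m : ℤ => f (2 * m + (p - 1))) b) : HasSum f (a + b) := by
  have hc : IsCompl (Set.range fun m : ℤ => 2 * m + p)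
      (Set.range fun m : ℤ => 2 * m + (p - 1)) := by
    refine ⟨Set.disjoint_left.2 ?_, codisjoint_iff_le_sup.2 fun x _ => ?_⟩
    · rintro _ ⟨a, rfl⟩ ⟨b, hb⟩
      simp only at hb
      omega
    · rcases Int.even_or_odd' (x - p) with ⟨a, ha | ha⟩
      · exact Or.inl ⟨a, by simp only; omega⟩
      · exact Or.inr ⟨a + 1, by simp only; omega⟩
  exact ((lattice_injective p).hasSum_range_iff.2 ha).add_isCompl hc
    ((lattice_injective (p - 1)).hasSum_range_iff.2 hb)

theorem hasSum_even_add_odd {f : ℤ → ℝ} {c : ℝ} (hf : HasSum f c) (p : ℤ) :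
    HasSum (fun m : ℤ => f (2 * m + p) + f (2 * m + p - 1)) c := by
  have h1 := (hf.summable.comp_injective (lattice_injective p)).hasSum
  have h2 := (hf.summable.comp_injective (lattice_injective (p - 1))).hasSum
  rw [hf.unique (hasSum_of_sublattices h1 h2)]
  simpa only [Function.comp_def, ← add_sub_assoc] using h1.add h2

/-- The orthogonality to constants, on each sublattice of step two. -/
theorem hasSum_weight_mul_qInvHermite (ht0 : 0 < t) (ht1 : t < 1) (hk : 0 < k) (p : ℤ) (N : ℕ) :
    HasSum (fun m : ℤ => weight t k (2 * m + p) * qInvHermite t N (node t k (2 * m + p)))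
      (if N = 0 then mass t k else 0) := by
  cases N with
  | zero =>
    -- The weight at `2 * m + p` collects the mass terms at that point and its left neighbour, so
    -- either coset recovers the full sum over `ℤ`.
    simp only [qInvHermite_zero, mul_one, weight_eq_add ht0 hk, if_true]
    exact hasSum_even_add_odd (hasSum_massTerm ht0 ht1 hk) p
  | succ N =>
    simp only [Nat.succ_ne_zero, if_false]
    -- The sequence on the opposite coset whose differences, by the raising relation, are a constant
    -- times the required terms.
    have hs : Summable fun m : ℤ => massTerm t k (2 * m + (p - 1)) *
        node t k (2 * m + (p - 1)) ^ (-1 : ℤ) *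
        (1 * qInvHermite t N (node t k (2 * m + (p - 1)))) :=
      (((rapidlySummable_one ht0 ht1 hk).mul_qInvHermite ht0 hk N) (-1)).comp_injective
        (lattice_injective (p - 1))
    have h1 := hs.hasSum
    have h2 := (Equiv.addRight (1 : ℤ)).hasSum_iff.2 h1
    have h3 := (h2.sub h1).mul_left (t⁻¹ * (1 - (t ^ 4) ^ (N + 1))⁻¹)
    rw [sub_self, mul_zero] at h3
    refine hasSum_of_eq h3 (fun m => ?_) rfl
    have hX := (node_pos ht0 hk (2 * m + p)).ne'
    have hq := (one_sub_pow_four_pos ht0 ht1 N).ne'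
    have hr := qInvHermite_raising ht0 ht1 N hX
    have e1 : 2 * (m + 1) + (p - 1) = 2 * m + p + 1 := by ring
    have e2 : 2 * m + (p - 1) = 2 * m + p - 1 := by ring
    simp only [Function.comp_apply, Equiv.coe_addRight, e1, e2, massTerm_add_one ht0 hk,
      massTerm_sub_one ht0 hk, node_add_one ht0, node_sub_one ht0, zpow_neg_one, weight]
    generalize node t k (2 * m + p) = z at *
    generalize qInvHermite t N (z * t ^ 2) = a at *
    generalize qInvHermite t N (z / t ^ 2) = b at *
    field_simp
    field_simp at hr
    linear_combination massTerm t k (2 * m + p) * hr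

theorem hasSum_weight_mul_qInvHermite_mul (ht0 : 0 < t) (ht1 : t < 1) (hk : 0 < k) (p : ℤ)
    (M N : ℕ) :
    HasSum (fun m : ℤ => weight t k (2 * m + p) * (qInvHermite t M (node t k (2 * m + p)) *
        qInvHermite t N (node t k (2 * m + p))))
      (if M = N then mass t k / (t ^ (2 * N) * qPoch (t ^ 4) (t ^ 4) N) else 0) := by
  -- Prepending a zero to the sequence makes the three-term recurrence uniform.
  let P : ℕ → ℝ → ℝ := fun n z => n.casesOn 0 fun i => qInvHermite t i z
  let d : ℕ → ℝ := fun n =>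
    n.casesOn 0 fun i => mass t k / (t ^ (2 * i) * qPoch (t ^ 4) (t ^ 4) i)
  have hP : ∀ n {z : ℝ}, z ≠ 0 → (1 - (t ^ 4) ^ (n + 1)) * P (n + 2) z + P n z =
      t ^ (2 * n + 1) * (z - z⁻¹) * P (n + 1) z := by
    rintro (_ | n) z hz
    · change (1 - (t ^ 4) ^ (0 + 1)) * qInvHermite t 1 z + 0 =
        t ^ (2 * 0 + 1) * (z - z⁻¹) * qInvHermite t 0 z
      rw [qInvHermite_zero]
      linear_combination qInvHermite_one ht0 ht1 hz
    · exact qInvHermite_three_term ht0 ht1 n hz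
  have hd : ∀ n, d (n + 1) = t ^ 2 * (1 - (t ^ 4) ^ (n + 1)) * d (n + 2) := fun n => by
    have h1 := (qPoch_pow_four_pos ht0 ht1 n).ne'
    have h2 := (one_sub_pow_four_pos ht0 ht1 n).ne'
    simp only [d, qPoch_self_succ]
    field_simp
    ring
  suffices H : ∀ m n, HasSum (fun i : ℤ => weight t k (2 * i + p) *
      (P m (node t k (2 * i + p)) * P n (node t k (2 * i + p)))) (if m = n then d n else 0) by
    simpa [P, d] using H (M + 1) (N + 1)
  intro m
  induction m using Nat.twoStepInduction with
  | zero =>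
    rintro (_ | n) <;> simp [P, d, hasSum_zero]
  | one =>
    rintro (_ | n)
    · simp [P, d, hasSum_zero]
    · have h := hasSum_weight_mul_qInvHermite ht0 ht1 hk p n
      convert h using 1
      · simp [P, qInvHermite_zero]
      · rcases n with _ | n <;> simp [d, qPoch_zero]
  | more m ih0 ih1 =>
    rintro (_ | n)
    · simp [P, hasSum_zero]
    · have hm := (one_sub_pow_four_pos ht0 ht1 m).ne'
      -- The recurrence in `m` produces the factor `z - z⁻¹`, which the recurrence in `n` transfers
      -- to the other polynomial; the ratio of powers of `t` compares their coefficients.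
      have h := (((((ih1 (n + 2)).mul_left (1 - (t ^ 4) ^ (n + 1))).add (ih1 n)).mul_left
        (t ^ (2 * m + 1) / t ^ (2 * n + 1))).sub (ih0 (n + 1))).mul_left
        (1 - (t ^ 4) ^ (m + 1))⁻¹
      refine hasSum_of_eq h (fun i => ?_) ?_
      · have hz := (node_pos ht0 hk (2 * i + p)).ne'
        have h1 := hP m hz
        have h2 := hP n hz
        generalize node t k (2 * i + p) = z at *
        rw [eq_inv_mul_iff_mul_eq₀ hm]
        have h3 : (1 - (t ^ 4) ^ (n + 1)) * P (n + 2) z =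
          t ^ (2 * n + 1) * (z - z⁻¹) * P (n + 1) z - P n z := by linear_combination h2
        have h4 : (1 - (t ^ 4) ^ (m + 1)) * P (m + 2) z =
          t ^ (2 * m + 1) * (z - z⁻¹) * P (m + 1) z - P m z := by linear_combination h1
        have ht : t ^ (2 * m + 1) / t ^ (2 * n + 1) * t ^ (2 * n + 1) = t ^ (2 * m + 1) :=
          div_mul_cancel₀ _ (by positivity)
        linear_combination weight t k (2 * i + p) * P (n + 1) z * h4 -
          t ^ (2 * m + 1) / t ^ (2 * n + 1) * weight t k (2 * i + p) * P (m + 1) z * h3 -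
          weight t k (2 * i + p) * P (m + 1) z * P (n + 1) z * (z - z⁻¹) * ht
      · rw [eq_inv_mul_iff_mul_eq₀ hm]
        rcases eq_or_ne n (m + 1) with rfl | h1
        · rw [if_pos rfl, if_neg (by omega), if_pos rfl, if_neg (by omega), hd m]
          field_simp
          ring
        · rcases eq_or_ne m (n + 1) with rfl | h2
          · rw [if_neg (by omega), if_pos rfl, if_neg (by omega), if_pos rfl, hd n]
            field_simp
            ring
          · rw [if_neg (by omega), if_neg (by omega), if_neg (by omega), if_neg (by omega)]
            ring

end Lattice

/-! ### Completeness criteria in `ℓ²`. -/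

section EllTwo

variable {𝕜 : Type*} [RCLike 𝕜] {ι : Type*}

theorem memℓp_two_ofReal {f : ι → ℝ} (hf : Summable fun x => f x * f x) :
    Memℓp (fun x => (f x : 𝕜)) 2 := by
  refine memℓp_gen ?_
  simpa [RCLike.norm_ofReal, sq_abs, pow_two] using hf

/-- A real square summable family, as a vector of `ℓ²` with scalars `𝕜`. -/
def ofSquareSummable (𝕜 : Type*) [RCLike 𝕜] (f : ι → ℝ) (hf : Summable fun x => f x * f x) :
    lp (fun _ : ι => 𝕜) 2 :=
  ⟨fun x => (f x : 𝕜), memℓp_two_ofReal hf⟩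

theorem inner_eq_of_hasSum {f g : ι → ℝ} {c : ℝ} {u v : lp (fun _ : ι => 𝕜) 2}
    (hu : ∀ x, u x = (f x : 𝕜)) (hv : ∀ x, v x = (g x : 𝕜))
    (h : HasSum (fun x => f x * g x) c) : inner 𝕜 u v = (c : 𝕜) := by
  refine (lp.hasSum_inner u v).unique ?_
  have h1 := (RCLike.ofRealCLM (K := 𝕜)).hasSum h
  rw [RCLike.ofRealCLM_apply] at h1
  have e : (fun x => inner 𝕜 (u x) (v x)) = RCLike.ofRealCLM (K := 𝕜) ∘ fun x => f x * g x := by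
    ext x
    simp [hu, hv, mul_comm]
  rw [e]
  exact h1

theorem orthonormal_of_hasSum {f : ℕ → ι → ℝ} {e : ℕ → lp (fun _ : ι => 𝕜) 2}
    (he : ∀ n x, e n x = (f n x : 𝕜))
    (h : ∀ m n, HasSum (fun x => f m x * f n x) (if m = n then 1 else 0)) :
    Orthonormal 𝕜 e := by
  rw [orthonormal_iff_ite]
  intro m n
  rw [inner_eq_of_hasSum (he m) (he n) (h m n)]
  split_ifs <;> simp

theorem inner_single_one_left [DecidableEq ι] (x : ι) (v : lp (fun _ : ι => 𝕜) 2) :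
    inner 𝕜 (lp.single 2 x (1 : 𝕜)) v = v x := by
  rw [lp.inner_single_left]
  simp

theorem summable_sq_apply_of_orthonormal {e : ℕ → lp (fun _ : ι => 𝕜) 2}
    (he : Orthonormal 𝕜 e) (x : ι) : Summable fun n => ‖e n x‖ ^ 2 := by
  classical
  have := he.inner_products_summable (x := lp.single 2 x (1 : 𝕜))
  refine this.congr fun n => ?_
  rw [← inner_conj_symm, inner_single_one_left, RCLike.norm_conj]

/-- By Bessel, `u = ∑ f n y • e n` converges in `ℓ²`. Its coordinates off `y` vanish, and the one at
`y` is positive already because of the term `n = 0`; so `u` is a nonzero multiple of the point mass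
at `y`. A vector orthogonal to all `e n` therefore vanishes at `y`. The value of the diagonal sum is
not needed. -/
theorem isCompleteSystem_of_tendsto {f : ℕ → ι → ℝ} {e : ℕ → lp (fun _ : ι => 𝕜) 2}
    (he : ∀ n x, e n x = (f n x : 𝕜)) (ho : Orthonormal 𝕜 e)
    (hoff : ∀ x y, x ≠ y →
      Tendsto (fun N => ∑ n ∈ Finset.range N, f n x * f n y) atTop (𝓝 0))
    (h0 : ∀ x, f 0 x ≠ 0) : IsCompleteSystem 𝕜 e := by
  classical
  rw [IsCompleteSystem, Submodule.topologicalClosure_eq_top_iff, Submodule.eq_bot_iff]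
  intro v hv
  have hv' : ∀ n, inner 𝕜 (e n) v = 0 := fun n =>
    (Submodule.mem_orthogonal _ _).1 hv _ (Submodule.subset_span ⟨n, rfl⟩)
  ext y
  have hsq := summable_sq_apply_of_orthonormal ho y
  have hmem : Memℓp (fun n => (f n y : 𝕜)) 2 := by
    refine memℓp_gen ?_
    simpa [he, pow_two] using hsq
  obtain ⟨u, hu⟩ : ∃ u, HasSum (fun n => (f n y : 𝕜) • e n) u :=
    ⟨_, by simpa using ho.orthogonalFamily.hasSum_linearIsometry ⟨_, hmem⟩⟩
  have hux : ∀ x, HasSum (fun n => (f n y : 𝕜) * (f n x : 𝕜)) (u x) := fun x => by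
    simpa [he, inner_single_one_left, inner_smul_right] using
      hu.mapL (innerSL 𝕜 (lp.single 2 x (1 : 𝕜)))
  have hoffx : ∀ x, x ≠ y → u x = 0 := fun x hx => by
    refine tendsto_nhds_unique (hux x).tendsto_sum_nat ?_
    have := ((RCLike.continuous_ofReal (K := 𝕜)).tendsto 0).comp (hoff x y hx)
    simpa [Function.comp_def, mul_comm] using this
  have huy : u y ≠ 0 := by
    have h1 : HasSum (fun n => f n y * f n y) (RCLike.re (u y)) := by
      simpa using RCLike.hasSum_re 𝕜 (hux y)
    have h2 : 0 < RCLike.re (u y) :=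
      (mul_self_pos.2 (h0 y)).trans_le
        (le_hasSum h1 0 fun n _ => mul_self_nonneg _)
    intro h
    simp [h] at h2
  have hus : u = u y • lp.single 2 y (1 : 𝕜) := by
    ext x
    by_cases hx : x = y
    · subst hx; simp
    · simp [hoffx x hx, hx]
  have huv : inner 𝕜 u v = 0 := by
    have := hu.mapL (innerSLFlip 𝕜 v)
    simp only [innerSLFlip_apply_apply, inner_smul_left, hv', mul_zero] at this
    exact this.unique hasSum_zero
  rw [hus, inner_smul_left, inner_single_one_left] at huv
  simpa [huy] using huv

/-- The completeness relation of a real orthonormal basis of `ℓ²`. -/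
theorem hasSum_mul_of_isCompleteSystem [DecidableEq ι] {f : ℕ → ι → ℝ}
    {e : ℕ → lp (fun _ : ι => 𝕜) 2} (he : ∀ n x, e n x = (f n x : 𝕜)) (ho : Orthonormal 𝕜 e)
    (hc : IsCompleteSystem 𝕜 e) (x y : ι) :
    HasSum (fun n => f n x * f n y) (if x = y then 1 else 0) := by
  have h := (HilbertBasis.mk ho hc.ge).hasSum_inner_mul_inner
    (lp.single 2 x (1 : 𝕜)) (lp.single 2 y (1 : 𝕜))
  have h2 := RCLike.hasSum_re 𝕜 h
  convert h2 using 1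
  · ext n
    rw [HilbertBasis.coe_mk, ← inner_conj_symm (e n), inner_single_one_left,
      inner_single_one_left, he, he]
    rw [RCLike.conj_ofReal, ← RCLike.ofReal_mul, RCLike.ofReal_re]
  · rw [inner_single_one_left]
    by_cases hxy : x = y
    · subst hxy; simp
    · simp [hxy]

/-- If each of `f 0, f 1, …` has squared norm `2` and these functions are orthogonal, while
`∑ f n x ^ 2 = 1` at some point `x`, then they do not span a dense subspace. -/
theorem not_isCompleteSystem {f : ℕ → ι → ℝ} {e : ℕ → lp (fun _ : ι => 𝕜) 2}
    (he : ∀ n x, e n x = (f n x : 𝕜))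
    (h : ∀ m n, HasSum (fun x => f m x * f n x) (if m = n then 2 else 0)) (x : ι)
    (hx : HasSum (fun n => f n x * f n x) 1) : ¬ IsCompleteSystem 𝕜 e := by
  classical
  intro hc
  set r : ℝ := (Real.sqrt 2)⁻¹ with hr
  have hr0 : r ≠ 0 := by positivity
  have hrr : r * r = 1 / 2 := by
    rw [hr, ← mul_inv, Real.mul_self_sqrt (by norm_num)]
    norm_num
  have he' : ∀ n x, ((r : 𝕜) • e n) x = ((r * f n x : ℝ) : 𝕜) := fun n x => by simp [he]
  have ho : Orthonormal 𝕜 fun n => (r : 𝕜) • e n := by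
    refine orthonormal_of_hasSum he' fun m n => ?_
    have h1 := (h m n).mul_left (r * r)
    refine hasSum_of_eq h1 (fun x => by ring) ?_
    by_cases hmn : m = n <;> simp [hmn, hrr]
  have hc' : IsCompleteSystem 𝕜 fun n => (r : 𝕜) • e n := by
    rw [IsCompleteSystem, eq_top_iff, ← hc]
    refine Submodule.topologicalClosure_mono (Submodule.span_le.2 ?_)
    rintro _ ⟨n, rfl⟩
    have : e n = (r : 𝕜)⁻¹ • ((r : 𝕜) • e n) := by
      rw [smul_smul, inv_mul_cancel₀ (by exact_mod_cast hr0), one_smul]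
    rw [this]
    exact Submodule.smul_mem _ _ (Submodule.subset_span ⟨n, rfl⟩)
  -- Parseval for the rescaled family gives `1` at `x`, whereas `hx` gives `1 / 2`.
  have h1 := hasSum_mul_of_isCompleteSystem he' ho hc' x x
  have h2 := hx.mul_left (r * r)
  have h3 : (1 : ℝ) = 1 / 2 := by
    rw [if_pos rfl] at h1
    rw [← hrr, ← mul_one (r * r)]
    exact h1.unique (by simpa only [mul_mul_mul_comm] using h2)
  norm_num at h3

end EllTwo

/-! ### Infinite products and the theta function. -/

theorem summable_norm_neg_mul_pow (a : ℝ) {q : ℝ} (hq0 : 0 < q) (hq1 : q < 1) :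
    Summable fun j : ℕ => ‖-(a * q ^ j)‖ := by
  simp only [norm_neg, norm_mul]
  exact (summable_geometric_of_lt_one hq0.le hq1).norm.mul_left _

theorem multipliable_qPoch (a : ℝ) {q : ℝ} (hq0 : 0 < q) (hq1 : q < 1) :
    Multipliable fun j : ℕ => 1 - a * q ^ j := by
  simpa only [sub_eq_add_neg] using
    multipliable_one_add_of_summable (summable_norm_neg_mul_pow a hq0 hq1)

theorem qPochInf_ne_zero {a q : ℝ} (hq0 : 0 < q) (hq1 : q < 1) (ha : ∀ j : ℕ, a * q ^ j ≠ 1) :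
    qPochInf a q ≠ 0 := by
  simp only [qPochInf, sub_eq_add_neg]
  refine tprod_one_add_ne_zero_of_summable (fun j h => ha j ?_)
    (summable_norm_neg_mul_pow a hq0 hq1)
  linarith

theorem tendsto_qPoch (a : ℝ) {q : ℝ} (hq0 : 0 < q) (hq1 : q < 1) :
    Tendsto (qPoch a q) atTop (𝓝 (qPochInf a q)) :=
  (multipliable_qPoch a hq0 hq1).hasProd.tendsto_prod_nat

theorem qPochInf_eq_mul (a : ℝ) {q : ℝ} (hq0 : 0 < q) (hq1 : q < 1) :
    qPochInf a q = (1 - a) * qPochInf (a * q) q := by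
  have h : (fun j : ℕ => 1 - a * q * q ^ j) = fun j => 1 - a * q ^ (j + 1) := by
    ext j
    ring
  have hm := multipliable_qPoch (a * q) hq0 hq1
  rw [h] at hm
  rw [qPochInf, qPochInf, h, tprod_eq_zero_mul' (f := fun j : ℕ => 1 - a * q ^ j) hm, pow_zero,
    mul_one]

theorem mul_theta_mul {q : ℝ} (hq0 : 0 < q) (hq1 : q < 1) {z : ℝ} (hz : z ≠ 0) :
    z * theta q (z * q) = -theta q z := by
  have h1 := qPochInf_eq_mul z hq0 hq1
  have h2 := qPochInf_eq_mul z⁻¹ hq0 hq1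
  have e1 : q / (z * q) = z⁻¹ := by field_simp
  have e2 : q / z = z⁻¹ * q := by field_simp
  rw [theta, theta, e1, e2, h1, h2]
  field_simp
  ring

theorem theta_zpow {t k : ℝ} (ht0 : 0 < t) (ht1 : t < 1) (hk : 0 < k) (m : ℤ) :
    theta (t ^ 2) (k * t ^ (2 * m)) * ((-1) ^ m * k ^ m * t ^ (m * (m - 1))) =
      theta (t ^ 2) k := by
  have step : ∀ m : ℤ, theta (t ^ 2) (k * t ^ (2 * (m + 1))) *
      ((-1) ^ (m + 1) * k ^ (m + 1) * t ^ ((m + 1) * (m + 1 - 1))) =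
      theta (t ^ 2) (k * t ^ (2 * m)) * ((-1) ^ m * k ^ m * t ^ (m * (m - 1))) := fun m => by
    have hz : k * t ^ (2 * m) ≠ 0 := by positivity
    have h := mul_theta_mul (q := t ^ 2) (by positivity) (pow_lt_one₀ ht0.le ht1 (by simp)) hz
    have e1 : k * t ^ (2 * (m + 1)) = k * t ^ (2 * m) * t ^ 2 := by
      rw [mul_assoc, ← zpow_natCast t 2, ← zpow_add₀ ht0.ne']
      congr 2
      push_cast
      ring
    have e2 : t ^ ((m + 1) * (m + 1 - 1)) = t ^ (2 * m) * t ^ (m * (m - 1)) := by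
      rw [← zpow_add₀ ht0.ne']
      congr 1
      ring
    rw [e1, e2, zpow_add_one₀ hk.ne', zpow_add_one₀ (by norm_num)]
    linear_combination (-(-1) ^ m * k ^ m * t ^ (m * (m - 1))) * h
  induction m using Int.induction_on with
  | zero => simp
  | succ i ih => rw [step, ih]
  | pred i ih => rw [← step, sub_add_cancel, ih]

theorem theta_ne_zero {t k : ℝ} (ht0 : 0 < t) (ht1 : t < 1) (hk : 0 < k)
    (h : ∀ m : ℤ, k ≠ t ^ (2 * m)) : theta (t ^ 2) k ≠ 0 := by
  have hs0 : 0 < t ^ 2 := by positivity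
  have hs1 : t ^ 2 < 1 := pow_lt_one₀ ht0.le ht1 (by simp)
  refine mul_ne_zero (qPochInf_ne_zero hs0 hs1 fun j hj => h (-j) ?_)
    (qPochInf_ne_zero hs0 hs1 fun j hj => h (j + 1) ?_)
  · rw [mul_neg, zpow_neg, zpow_mul]
    exact eq_inv_of_mul_eq_one_left (by exact_mod_cast hj)
  · rw [div_mul_eq_mul_div, div_eq_one_iff_eq hk.ne'] at hj
    rw [← hj, ← pow_succ', zpow_mul]
    norm_cast

/-! ### The normalized functions and the vanishing of their kernel off the diagonal. -/

section Basis

variable {t k : ℝ}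

/-- The normalized functions `𝓕_n`, up to a common sign, at the lattice point `X / 2`. -/
noncomputable def basisFn (t k : ℝ) (N : ℕ) (X : ℤ) : ℝ :=
  (-1) ^ X * (Real.sqrt (weight t k X / mass t k) *
    (Real.sqrt (t ^ (2 * N) * qPoch (t ^ 4) (t ^ 4) N) * qInvHermite t N (node t k X)))

theorem neg_one_zpow_mul_self (X : ℤ) : (-1 : ℝ) ^ X * (-1) ^ X = 1 := by
  rw [← mul_zpow]
  simp

theorem basisFn_zero_ne_zero (ht0 : 0 < t) (ht1 : t < 1) (hk : 0 < k) (X : ℤ) :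
    basisFn t k 0 X ≠ 0 := by
  have h := div_pos (weight_pos ht0 hk X) (mass_pos ht0 ht1 hk)
  simp only [basisFn, qInvHermite_zero, qPoch_zero, mul_zero, pow_zero, mul_one, Real.sqrt_one]
  exact mul_ne_zero (zpow_ne_zero _ (by norm_num)) (Real.sqrt_pos.2 h).ne'

theorem hasSum_basisFn_mul (ht0 : 0 < t) (ht1 : t < 1) (hk : 0 < k) (p : ℤ) (M N : ℕ) :
    HasSum (fun m : ℤ => basisFn t k M (2 * m + p) * basisFn t k N (2 * m + p))
      (if M = N then 1 else 0) := by
  have hS := mass_pos ht0 ht1 hk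
  have h := (hasSum_weight_mul_qInvHermite_mul ht0 ht1 hk p M N).mul_left
    ((mass t k)⁻¹ * (Real.sqrt (t ^ (2 * M) * qPoch (t ^ 4) (t ^ 4) M) *
      Real.sqrt (t ^ (2 * N) * qPoch (t ^ 4) (t ^ 4) N)))
  refine hasSum_of_eq h (fun m => ?_) ?_
  · have hw := Real.mul_self_sqrt
      (div_pos (weight_pos ht0 hk (2 * m + p)) (mass_pos ht0 ht1 hk)).le
    rw [div_eq_inv_mul] at hw
    simp only [basisFn]
    rw [div_eq_inv_mul]
    generalize Real.sqrt ((mass t k)⁻¹ * weight t k (2 * m + p)) = r at *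
    rw [← mul_assoc _ (weight t k (2 * m + p)), mul_right_comm (mass t k)⁻¹, ← hw]
    linear_combination (r * r * Real.sqrt (t ^ (2 * M) * qPoch (t ^ 4) (t ^ 4) M) *
      Real.sqrt (t ^ (2 * N) * qPoch (t ^ 4) (t ^ 4) N) *
      qInvHermite t M (node t k (2 * m + p)) * qInvHermite t N (node t k (2 * m + p))) *
      neg_one_zpow_mul_self (2 * m + p)
  · by_cases hMN : M = N
    · subst hMN
      have hc : 0 < t ^ (2 * M) * qPoch (t ^ 4) (t ^ 4) M :=
        mul_pos (by positivity) (qPoch_pow_four_pos ht0 ht1 M)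
      rw [if_pos rfl, if_pos rfl, Real.mul_self_sqrt hc.le]
      generalize t ^ (2 * M) * qPoch (t ^ 4) (t ^ 4) M = c at *
      field_simp
    · simp [hMN]

/-- Bessel's inequality makes the values of the orthonormal functions at a point square summable in
`N`. Their normalization is `t ^ N` times a factor with a nonzero limit. -/
theorem tendsto_pow_mul_qInvHermite (ht0 : 0 < t) (ht1 : t < 1) (hk : 0 < k) (X : ℤ) :
    Tendsto (fun N => t ^ N * qInvHermite t N (node t k X)) atTop (𝓝 0) := by
  have ho := fun N => hasSum_basisFn_mul ht0 ht1 hk X N N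
  let e : ℕ → lp (fun _ : ℤ => ℝ) 2 := fun N => ofSquareSummable ℝ _ (ho N).summable
  have heo : Orthonormal ℝ e :=
    orthonormal_of_hasSum (fun _ _ => rfl) (hasSum_basisFn_mul ht0 ht1 hk X)
  have h1 := (summable_sq_apply_of_orthonormal heo 0).tendsto_atTop_zero
  have hq0 : 0 < t ^ 4 := by positivity
  have hq1 : t ^ 4 < 1 := pow_lt_one₀ ht0.le ht1 (by simp)
  have hq : qPochInf (t ^ 4) (t ^ 4) ≠ 0 := qPochInf_ne_zero hq0 hq1 fun j => by
    rw [← pow_succ']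
    exact (pow_lt_one₀ hq0.le hq1 (by simp)).ne
  have hr := div_pos (weight_pos ht0 hk X) (mass_pos ht0 ht1 hk)
  have h2 := (h1.div_const (weight t k X / mass t k)).div (tendsto_qPoch (t ^ 4) hq0 hq1) hq
  rw [zero_div, zero_div] at h2
  have h3 := h2.sqrt
  rw [Real.sqrt_zero] at h3
  refine (tendsto_zero_iff_abs_tendsto_zero _).2 (h3.congr fun N => ?_)
  rw [Function.comp_apply, ← Real.sqrt_sq_eq_abs]
  congr 1
  have hp := qPoch_pow_four_pos ht0 ht1 N
  have hc : 0 < t ^ (2 * N) * qPoch (t ^ 4) (t ^ 4) N := mul_pos (by positivity) hp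
  have hb : ‖e N 0‖ ^ 2 = weight t k X / mass t k * (t ^ (2 * N) * qPoch (t ^ 4) (t ^ 4) N *
      qInvHermite t N (node t k X) ^ 2) := by
    change ‖basisFn t k N (2 * 0 + X)‖ ^ 2 = _
    rw [Real.norm_eq_abs, sq_abs, basisFn, mul_zero, zero_add, mul_pow, mul_pow, mul_pow,
      Real.sq_sqrt hc.le, Real.sq_sqrt hr.le, pow_two ((-1 : ℝ) ^ X), neg_one_zpow_mul_self,
      one_mul]
  simp only [Pi.div_apply, hb]
  rw [mul_div_cancel_left₀ _ hr.ne']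
  field_simp
  ring

/-- One lattice step relates degree `N + 1` to degree `N` up to small terms, so two steps lower the
degree by two; the three-term recurrence returns to the original degree with a sign. This is why
only nodes of equal parity are comparable. -/
theorem tendsto_node_add_two (ht0 : 0 < t) (ht1 : t < 1) (hk : 0 < k) (X : ℤ) :
    Tendsto (fun N => (t ^ N)⁻¹ * (qInvHermite t N (node t k (X + 2)) -
      -(t ^ 4 * node t k X ^ 2)⁻¹ * qInvHermite t N (node t k X))) atTop (𝓝 0) := by
  rw [← tendsto_add_atTop_iff_nat 2]
  have ha := fun X => tendsto_pow_mul_qInvHermite ht0 ht1 hk X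
  have h1 := (tendsto_add_atTop_iff_nat 2).2 (ha (X + 1))
  have h2 := (tendsto_add_atTop_iff_nat 1).2 (ha X)
  have h3 := (tendsto_add_atTop_iff_nat 2).2 (ha X)
  have hp : Tendsto (fun N : ℕ => t ^ N) atTop (𝓝 0) :=
    tendsto_pow_atTop_nhds_zero_of_lt_one ht0.le ht1
  have hz := node_pos ht0 hk X
  set z := node t k X with hzdef
  -- These are the remainders: each carries a factor `t ^ (2 * N)` or smaller, so it tends to zero
  -- even after division by `t ^ N`.
  have h4 := ((h1.sub (h2.mul_const (t⁻¹ * (z * t ^ 3)⁻¹))).add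
    ((h2.mul_const ((z - z⁻¹) * (t ^ 4 * z ^ 2)⁻¹)))).add
    (((hp.pow 2).mul h3).mul_const (t ^ 4 * (t ^ 4 * z ^ 2)⁻¹))
  simp only [zero_mul, mul_zero, sub_zero, add_zero] at h4
  refine h4.congr fun N => ?_
  have hz1 := (node_pos ht0 hk (X + 1)).ne'
  have r1 := qInvHermite_mul_sq ht0 ht1 (N + 1) hz1
  have r2 := qInvHermite_mul_sq ht0 ht1 N hz.ne'
  have r3 := qInvHermite_three_term ht0 ht1 N hz.ne'
  have hn : node t k (X + 1) = z * t ^ 2 := node_add_one ht0 X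
  rw [← node_add_one ht0, add_assoc X, one_add_one_eq_two] at r1
  rw [← hn] at r2
  have r3' : qInvHermite t N z = t ^ (2 * N + 3) * (z - z⁻¹) * qInvHermite t (N + 1) z -
      (1 - (t ^ 4) ^ (N + 2)) * qInvHermite t (N + 2) z := by linear_combination r3
  rw [r1, r2, r3', hn]
  generalize qInvHermite t (N + 2) (z * t ^ 2) = a
  generalize qInvHermite t (N + 2) z = b
  generalize qInvHermite t (N + 1) z = c
  field_simp
  ring

theorem tendsto_node_add_two_mul (ht0 : 0 < t) (ht1 : t < 1) (hk : 0 < k) (X : ℤ) (m : ℕ) :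
    ∃ c : ℝ, Tendsto (fun N => (t ^ N)⁻¹ * (qInvHermite t N (node t k (X + 2 * m)) -
      c * qInvHermite t N (node t k X))) atTop (𝓝 0) := by
  induction m with
  | zero => exact ⟨1, by simp⟩
  | succ m ih =>
    obtain ⟨c, hc⟩ := ih
    have h := tendsto_node_add_two ht0 ht1 hk (X + 2 * m)
    refine ⟨-(t ^ 4 * node t k (X + 2 * m) ^ 2)⁻¹ * c, ?_⟩
    have h2 := h.add (hc.const_mul (-(t ^ 4 * node t k (X + 2 * m) ^ 2)⁻¹))
    rw [mul_zero, add_zero] at h2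
    refine h2.congr fun N => ?_
    have e : X + 2 * ((m + 1 : ℕ) : ℤ) = X + 2 * m + 2 := by push_cast; ring
    rw [e]
    ring

theorem node_sub_inv_injective (ht0 : 0 < t) (ht1 : t < 1) (hk : 0 < k) :
    Function.Injective fun X : ℤ => node t k X - (node t k X)⁻¹ := by
  have hanti : StrictAnti fun X : ℤ => node t k X := fun X Y hXY =>
    mul_lt_mul_of_pos_left (zpow_lt_zpow_right_of_lt_one₀ ht0 ht1 (by omega)) hk
  refine StrictAnti.injective fun X Y hXY => ?_
  have h1 := hanti hXY
  have h2 := inv_strictAnti₀ (node_pos ht0 hk Y) h1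
  simp only at h1 ⊢
  linarith

theorem tendsto_sum_qInvHermite (ht0 : 0 < t) (ht1 : t < 1) (hk : 0 < k) (X : ℤ) {m : ℕ}
    (hm : m ≠ 0) :
    Tendsto (fun N => ∑ n ∈ Finset.range N, qPoch (t ^ 4) (t ^ 4) n * t ^ (2 * n) *
      (qInvHermite t n (node t k X) * qInvHermite t n (node t k (X + 2 * m)))) atTop (𝓝 0) := by
  rw [← tendsto_add_atTop_iff_nat 1]
  obtain ⟨c, hc⟩ := tendsto_node_add_two_mul ht0 ht1 hk X m
  have hX := tendsto_pow_mul_qInvHermite ht0 ht1 hk X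
  have hX1 := (tendsto_add_atTop_iff_nat 1).2 hX
  have hc1 := (tendsto_add_atTop_iff_nat 1).2 hc
  -- Subtracting `c` times the values at `X` from those at `X + 2 * m` leaves the antisymmetric
  -- Wronskian unchanged. Each product then pairs a factor scaled by a power of `t` with one scaled
  -- by an inverse power, and both tend to zero.
  have h1 := ((hX1.mul hc).const_mul t⁻¹).sub ((hX.mul hc1).const_mul t)
  rw [mul_zero, mul_zero, mul_zero, sub_zero] at h1
  have hq := tendsto_qPoch (t ^ 4) (q := t ^ 4) (by positivity)
    (pow_lt_one₀ ht0.le ht1 (by simp))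
  have h2 := ((tendsto_add_atTop_iff_nat 1).2 hq).mul h1
  rw [mul_zero] at h2
  have hz := (node_pos ht0 hk X).ne'
  have hw := (node_pos ht0 hk (X + 2 * m)).ne'
  have hne : node t k X - (node t k X)⁻¹ -
      (node t k (X + 2 * m) - (node t k (X + 2 * m))⁻¹) ≠ 0 := fun h => by
    have := node_sub_inv_injective ht0 ht1 hk (sub_eq_zero.1 h)
    omega
  have h3 := h2.const_mul (t * (node t k X - (node t k X)⁻¹ -
      (node t k (X + 2 * m) - (node t k (X + 2 * m))⁻¹)))⁻¹
  rw [mul_zero] at h3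
  refine h3.congr fun N => ?_
  rw [inv_mul_eq_iff_eq_mul₀ (mul_ne_zero ht0.ne' hne), christoffel_darboux ht0 ht1 N hz hw]
  field_simp
  ring

theorem tendsto_sum_basisFn (ht0 : 0 < t) (ht1 : t < 1) (hk : 0 < k) {X Y : ℤ} (hXY : X ≠ Y)
    (hpar : Even (X - Y)) :
    Tendsto (fun N => ∑ n ∈ Finset.range N, basisFn t k n X * basisFn t k n Y) atTop (𝓝 0) := by
  wlog h : X < Y generalizing X Y
  · have := this hXY.symm (by rw [← neg_sub, even_neg]; exact hpar)
      (lt_of_le_of_ne (not_lt.1 h) hXY.symm)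
    simpa only [mul_comm] using this
  obtain ⟨i, hi⟩ := hpar
  obtain ⟨m, rfl⟩ : ∃ m : ℕ, Y = X + 2 * m := ⟨(-i).toNat, by omega⟩
  have h1 := (tendsto_sum_qInvHermite ht0 ht1 hk X (m := m) (by omega)).const_mul
    ((-1) ^ X * (-1) ^ (X + 2 * (m : ℤ)) * (Real.sqrt (weight t k X / mass t k) *
      Real.sqrt (weight t k (X + 2 * m) / mass t k)))
  rw [mul_zero] at h1
  refine h1.congr fun N => ?_
  rw [Finset.mul_sum]
  refine Finset.sum_congr rfl fun n _ => ?_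
  have hc : 0 < t ^ (2 * n) * qPoch (t ^ 4) (t ^ 4) n :=
    mul_pos (by positivity) (qPoch_pow_four_pos ht0 ht1 n)
  have hs := Real.mul_self_sqrt hc.le
  rw [basisFn, basisFn]
  linear_combination (-((-1) ^ X * (-1) ^ (X + 2 * (m : ℤ)) * (Real.sqrt (weight t k X / mass t k) *
    Real.sqrt (weight t k (X + 2 * m) / mass t k)) * qInvHermite t n (node t k X) *
    qInvHermite t n (node t k (X + 2 * m)))) * hs

end Basis

/-! ### Identification of `𝓕_n` with the weighted `q⁻¹`-Hermite polynomials. -/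

theorem pow_four_rpow {t : ℝ} (ht : 0 < t) {r : ℝ} {n : ℤ} (h : 4 * r = n) :
    (t ^ 4) ^ r = t ^ n := by
  rw [← Real.rpow_natCast t 4, ← Real.rpow_mul ht.le, ← Real.rpow_intCast, ← h]
  norm_num

theorem sqrt_weight {t k : ℝ} (ht0 : 0 < t) (hk : 0 < k) (X : ℤ) :
    Real.sqrt (weight t k X) =
      k ^ X * t ^ (X * (X + 1)) * Real.sqrt (1 + (node t k X ^ 2)⁻¹) := by
  have e : massTerm t k X = (k ^ X * t ^ (X * (X + 1))) ^ 2 := by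
    rw [massTerm, mul_pow, ← zpow_natCast, ← zpow_natCast, ← zpow_mul, ← zpow_mul]
    congr 2 <;> push_cast <;> ring
  rw [weight, e, Real.sqrt_mul (by positivity), Real.sqrt_sq (by positivity)]

theorem F_half_eq {t : ℝ} (ht0 : 0 < t) (ht1 : t < 1) {κ : ℂ} (hκre : κ.re = 0)
    (hκim : 0 < κ.im) (hθ : theta (t ^ 2) ‖κ‖ ≠ 0) (N : ℕ) (X : ℤ) :
    F (t ^ 4) κ N ((X : ℝ) / 2) = -(‖κ‖ / theta (t ^ 2) ‖κ‖) * ((-1) ^ X *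
      (Real.sqrt (weight t ‖κ‖ X) * qInvHermite t N (node t ‖κ‖ X))) := by
  have hκ : κ = ‖κ‖ * Complex.I := by
    have hn : ‖κ‖ = κ.im := by
      rw [← Complex.abs_im_eq_norm.2 hκre, abs_of_pos hκim]
    rw [hn]
    apply Complex.ext <;> simp [hκre]
  have hk : 0 < ‖κ‖ := norm_pos_iff.2 fun h => by simp [h] at hκim
  have hre : (1 - κ ^ (-2 : ℤ) * (((t ^ 4) ^ (-2 * ((X : ℝ) / 2)) : ℝ) : ℂ)).re =
      1 + (node t ‖κ‖ X ^ 2)⁻¹ := by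
    have e1 : (t ^ 4) ^ (-2 * ((X : ℝ) / 2)) = t ^ (-4 * X) :=
      pow_four_rpow ht0 (by push_cast; ring)
    have e2 : κ ^ (-2 : ℤ) = ((-(‖κ‖ ^ 2)⁻¹ : ℝ) : ℂ) := by
      rw [zpow_neg, show (2 : ℤ) = (2 : ℕ) from rfl, zpow_natCast]
      nth_rewrite 1 [hκ]
      rw [mul_pow, Complex.I_sq]
      push_cast
      rw [mul_neg_one, inv_neg]
    rw [e1, e2, ← Complex.ofReal_mul, Complex.sub_re, Complex.one_re, Complex.ofReal_re, node,
      mul_pow, mul_inv, ← zpow_natCast (t ^ (2 * X)), ← zpow_mul, ← zpow_neg]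
    rw [show -(2 * X * ((2 : ℕ) : ℤ)) = -4 * X by push_cast; ring]
    ring
  rw [F, hre, sqrt_weight ht0 hk, qInvHermite]
  generalize ‖κ‖ = k at *
  have hs : Real.sqrt (t ^ 4) = t ^ 2 := by
    rw [show t ^ 4 = (t ^ 2) ^ 2 by ring, Real.sqrt_sq (by positivity)]
  simp only [Finset.mul_sum]
  refine Finset.sum_congr rfl fun p _ => ?_
  obtain ⟨a, b⟩ := p
  simp only
  have e1 : (t ^ 4) ^ (-(((b : ℝ) - (a : ℝ)) / 2) / 2) = t ^ (-((b : ℤ) - a)) :=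
    pow_four_rpow ht0 (by push_cast; ring)
  have e2 : (t ^ 4) ^ ((X : ℝ) / 2 + ((b : ℝ) - (a : ℝ)) / 2 + 1 / 2) =
      t ^ (2 * (X + ((b : ℤ) - a) + 1)) := pow_four_rpow ht0 (by push_cast; ring)
  have hm : (-1) ^ b = (-1) ^ ((b : ℤ) - a) * (-1 : ℝ) ^ a := by
    rw [zpow_sub₀ (by norm_num), zpow_natCast, zpow_natCast, div_mul_cancel₀ _ (by simp)]
  rw [hs, e1, e2, hm]
  generalize (b : ℤ) - a = i
  have h1 := theta_zpow ht0 ht1 hk (X + i + 1)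
  have hne : theta (t ^ 2) (k * t ^ (2 * (X + i + 1))) ≠ 0 := fun h =>
    hθ (by rw [← h1, h, zero_mul])
  have h2 : 1 / theta (t ^ 2) (k * t ^ (2 * (X + i + 1))) =
      (-1) ^ (X + i + 1) * k ^ (X + i + 1) * t ^ ((X + i + 1) * (X + i + 1 - 1)) /
        theta (t ^ 2) k := by
    rw [div_eq_div_iff hne hθ, one_mul, ← h1]
    ring
  -- The four factors belong to the weight, the power of the node, the Gaussian coefficient of the
  -- polynomial, and a rest that cancels `q ^ (-i / 2)` of the definition (where `i` is half the
  -- present `i`).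
  have e3 : t ^ ((X + i + 1) * (X + i + 1 - 1)) =
      t ^ (X * (X + 1)) * t ^ (2 * X * i) * t ^ (i ^ 2) * t ^ i := by
    rw [← zpow_add₀ ht0.ne', ← zpow_add₀ ht0.ne', ← zpow_add₀ ht0.ne']
    congr 1
    ring
  have e4 : t ^ (-i) * t ^ i = 1 := by rw [← zpow_add₀ ht0.ne']; simp
  rw [h2, e3, zpow_add_one₀ hk.ne', zpow_add₀ hk.ne', zpow_add_one₀ (by norm_num),
    zpow_add₀ (by norm_num), node, mul_zpow, ← zpow_mul]
  have e5 := neg_one_zpow_mul_self i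
  generalize Real.sqrt (1 + _) = R
  generalize t ^ (-i) = T at *
  generalize t ^ i = T' at *
  generalize (-1 : ℝ) ^ i = s at *
  linear_combination (-(R * (k / theta (t ^ 2) k) * (-1) ^ X * (-1) ^ a * k ^ X * k ^ i *
    t ^ (X * (X + 1)) * t ^ (2 * X * i) * t ^ (i ^ 2) /
    (qPoch (t ^ 4) (t ^ 4) a * qPoch (t ^ 4) (t ^ 4) b))) * (T * T' * e5 + e4)

theorem exists_equiv_of_parametrization {S : Set ℝ} {g : ℤ → ℝ} (hg : Function.Injective g)
    (hS : S = Set.range g) : ∃ ψ : ℤ ≃ S, ∀ m, (ψ m : ℝ) = g m := by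
  subst hS
  exact ⟨Equiv.ofInjective g hg, fun _ => rfl⟩

theorem exists_equiv_integers : ∃ ψ : ℤ ≃ integers, ∀ m, (ψ m : ℝ) = ((2 * m + 0 : ℤ) : ℝ) / 2 := by
  refine exists_equiv_of_parametrization (fun a b h => ?_) ?_
  · simpa using h
  · ext x
    simp [integers, eq_comm]

theorem exists_equiv_shiftedIntegers :
    ∃ ψ : ℤ ≃ shiftedIntegers, ∀ m, (ψ m : ℝ) = ((2 * m + 1 : ℤ) : ℝ) / 2 := by
  refine exists_equiv_of_parametrization (fun a b h => ?_) ?_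
  · simpa using h
  · ext x
    simp only [shiftedIntegers, Set.mem_ofPred_eq, Set.mem_range]
    refine exists_congr fun m => ?_
    rw [eq_comm]
    push_cast
    rw [show (2 * (m : ℝ) + 1) / 2 = m + 1 / 2 by ring]

theorem exists_equiv_halfIntegers :
    ∃ ψ : ℤ ≃ halfIntegers, ∀ m, (ψ m : ℝ) = (m : ℝ) / 2 := by
  refine exists_equiv_of_parametrization (fun a b h => ?_) ?_
  · simpa using h
  · ext x
    simp [halfIntegers, eq_comm]

theorem exists_normalizedF_eq {t : ℝ} (ht0 : 0 < t) (ht1 : t < 1) {κ : ℂ} (hκre : κ.re = 0)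
    (hκim : 0 < κ.im) (hθ : theta (t ^ 2) ‖κ‖ ≠ 0) :
    ∃ σ : ℕ → ℝ, (∀ N, σ N * σ N = 1) ∧ ∀ N (X : ℤ),
      normalizedF (t ^ 4) κ N ((X : ℝ) / 2) = σ N * basisFn t ‖κ‖ N X := by
  have hk : 0 < ‖κ‖ := norm_pos_iff.2 fun h => by simp [h] at hκim
  have hS := mass_pos ht0 ht1 hk
  have hc : ∀ N, 0 < t ^ (2 * N) * qPoch (t ^ 4) (t ^ 4) N := fun N =>
    mul_pos (by positivity) (qPoch_pow_four_pos ht0 ht1 N)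
  let D : ℕ → ℝ := fun N => -(‖κ‖ / theta (t ^ 2) ‖κ‖) * Real.sqrt (mass t ‖κ‖) /
    Real.sqrt (t ^ (2 * N) * qPoch (t ^ 4) (t ^ 4) N)
  have hD : ∀ N, D N ≠ 0 := fun N =>
    div_ne_zero (mul_ne_zero (neg_ne_zero.2 (div_ne_zero hk.ne' hθ)) (Real.sqrt_pos.2 hS).ne')
      (Real.sqrt_pos.2 (hc N)).ne'
  have hF : ∀ N (X : ℤ), F (t ^ 4) κ N ((X : ℝ) / 2) = D N * basisFn t ‖κ‖ N X := fun N X => by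
    have h1 := (Real.sqrt_pos.2 hS).ne'
    have h2 := (Real.sqrt_pos.2 (hc N)).ne'
    simp only [F_half_eq ht0 ht1 hκre hκim hθ, D, basisFn,
      Real.sqrt_div (weight_pos ht0 hk X).le]
    generalize Real.sqrt (mass t ‖κ‖) = r at *
    generalize Real.sqrt (t ^ (2 * N) * qPoch (t ^ 4) (t ^ 4) N) = r' at *
    field_simp
  have hl : ∀ N, l2Norm integers (F (t ^ 4) κ N) = |D N| := fun N => by
    obtain ⟨ψ, hψ⟩ := exists_equiv_integers
    have h := (hasSum_basisFn_mul ht0 ht1 hk 0 N N).mul_left (D N ^ 2)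
    rw [if_pos rfl, mul_one] at h
    have h2 : HasSum (fun x : integers => F (t ^ 4) κ N x ^ 2) (D N ^ 2) := by
      rw [← ψ.hasSum_iff]
      refine hasSum_of_eq h (fun m => ?_) rfl
      rw [Function.comp_apply, hψ, hF]
      ring
    rw [l2Norm, h2.tsum_eq, Real.sqrt_sq_eq_abs]
  refine ⟨fun N => D N / |D N|, fun N => ?_, fun N X => ?_⟩
  · rw [div_mul_div_comm, abs_mul_abs_self, div_self (mul_ne_zero (hD N) (hD N))]
  · rw [normalizedF, hF, hl]
    ring

/-! ### Bases on the two cosets and failure on their union. -/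

section Completeness

variable {𝕜 : Type*} [RCLike 𝕜] {t k : ℝ}

/-- On each of the two cosets of `ℤ` in `½ℤ` the functions `basisFn` form, up to signs, an
orthonormal basis. -/
theorem exists_orthonormal_complete (ht0 : 0 < t) (ht1 : t < 1) (hk : 0 < k) {σ : ℕ → ℝ}
    (hσ : ∀ N, σ N * σ N = 1) {S : Set ℝ} {p : ℤ} {f : ℕ → ℝ → ℝ}
    (hf : ∀ N (X : ℤ), f N ((X : ℝ) / 2) = σ N * basisFn t k N X)
    (hS : ∃ ψ : ℤ ≃ S, ∀ m, (ψ m : ℝ) = ((2 * m + p : ℤ) : ℝ) / 2) :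
    ∃ e : ℕ → L2 𝕜 S, (∀ N x, e N x = ((f N x : ℝ) : 𝕜)) ∧ Orthonormal 𝕜 e ∧
      IsCompleteSystem 𝕜 e := by
  obtain ⟨ψ, hψ⟩ := hS
  have hfψ : ∀ N m, f N (ψ m) = σ N * basisFn t k N (2 * m + p) := fun N m => by rw [hψ, hf]
  have horth : ∀ M N, HasSum (fun x : S => f M x * f N x) (if M = N then 1 else 0) :=
    fun M N => by
      rw [← ψ.hasSum_iff]
      refine hasSum_of_eq ((hasSum_basisFn_mul ht0 ht1 hk p M N).mul_left (σ M * σ N))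
        (fun m => ?_) ?_
      · rw [Function.comp_apply, hfψ, hfψ]
        ring
      · by_cases h : M = N
        · simp [h, hσ]
        · simp [h]
  refine ⟨fun N => ofSquareSummable 𝕜 (fun x : S => f N x) (horth N N).summable,
    fun _ _ => rfl, orthonormal_of_hasSum (fun _ _ => rfl) horth,
    isCompleteSystem_of_tendsto (fun _ _ => rfl) (orthonormal_of_hasSum (fun _ _ => rfl) horth)
      (fun x y hxy => ?_) fun x => ?_⟩
  · obtain ⟨a, rfl⟩ := ψ.surjective x
    obtain ⟨b, rfl⟩ := ψ.surjective y
    have hab : a ≠ b := fun h => hxy (by rw [h])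
    refine (tendsto_sum_basisFn ht0 ht1 hk (X := 2 * a + p) (Y := 2 * b + p) (by omega)
      ⟨a - b, by ring⟩).congr fun N => Finset.sum_congr rfl fun n _ => ?_
    rw [hfψ, hfψ]
    linear_combination (-(basisFn t k n (2 * a + p) * basisFn t k n (2 * b + p))) * hσ n
  · obtain ⟨a, rfl⟩ := ψ.surjective x
    rw [hfψ]
    exact mul_ne_zero (left_ne_zero_of_mul_eq_one (hσ 0)) (basisFn_zero_ne_zero ht0 ht1 hk _)

theorem hasSum_mul_of_mem (ht0 : 0 < t) (ht1 : t < 1) (hk : 0 < k) {σ : ℕ → ℝ}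
    (hσ : ∀ N, σ N * σ N = 1) {S : Set ℝ} {p : ℤ} {f : ℕ → ℝ → ℝ}
    (hf : ∀ N (X : ℤ), f N ((X : ℝ) / 2) = σ N * basisFn t k N X)
    (hS : ∃ ψ : ℤ ≃ S, ∀ m, (ψ m : ℝ) = ((2 * m + p : ℤ) : ℝ) / 2) {x y : ℝ} (hx : x ∈ S)
    (hy : y ∈ S) : HasSum (fun N => f N x * f N y) (if x = y then 1 else 0) := by
  classical
  obtain ⟨e, he, ho, hc⟩ := exists_orthonormal_complete (𝕜 := ℝ) ht0 ht1 hk hσ hf hS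
  have h := hasSum_mul_of_isCompleteSystem (f := fun N (x : S) => f N x) he ho hc ⟨x, hx⟩ ⟨y, hy⟩
  simpa only [Subtype.mk.injEq] using h

theorem hasSum_mul_of_sub_mem_integers (ht0 : 0 < t) (ht1 : t < 1) (hk : 0 < k) {σ : ℕ → ℝ}
    (hσ : ∀ N, σ N * σ N = 1) {f : ℕ → ℝ → ℝ}
    (hf : ∀ N (X : ℤ), f N ((X : ℝ) / 2) = σ N * basisFn t k N X) {x y : ℝ}
    (hx : x ∈ halfIntegers) (hxy : x - y ∈ integers) :
    HasSum (fun N => f N x * f N y) (if x = y then 1 else 0) := by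
  obtain ⟨a, rfl⟩ := hx
  obtain ⟨c, hc⟩ := hxy
  obtain rfl : y = (a : ℝ) / 2 - c := by linarith
  rcases Int.even_or_odd' a with ⟨i, hi | hi⟩
  · refine hasSum_mul_of_mem ht0 ht1 hk hσ hf exists_equiv_integers ⟨i, ?_⟩ ⟨i - c, ?_⟩ <;>
      rw [hi] <;> push_cast <;> ring
  · refine hasSum_mul_of_mem ht0 ht1 hk hσ hf exists_equiv_shiftedIntegers ⟨i, ?_⟩ ⟨i - c, ?_⟩ <;>
      rw [hi] <;> push_cast <;> ring

theorem exists_not_complete (ht0 : 0 < t) (ht1 : t < 1) (hk : 0 < k) {σ : ℕ → ℝ}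
    (hσ : ∀ N, σ N * σ N = 1) {f : ℕ → ℝ → ℝ}
    (hf : ∀ N (X : ℤ), f N ((X : ℝ) / 2) = σ N * basisFn t k N X)
    (h0 : HasSum (fun N => f N 0 * f N 0) 1) :
    ∃ e : ℕ → L2 𝕜 halfIntegers, (∀ N x, e N x = ((f N x : ℝ) : 𝕜)) ∧
      ¬ IsCompleteSystem 𝕜 e := by
  obtain ⟨ψ, hψ⟩ := exists_equiv_halfIntegers
  have horth : ∀ M N,
      HasSum (fun x : halfIntegers => f M x * f N x) (if M = N then 2 else 0) := fun M N => by
    rw [← ψ.hasSum_iff]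
    -- Each coset contributes `1` when `M = N`, hence the squared norm `2`.
    have h := (hasSum_of_sublattices (f := fun X => basisFn t k M X * basisFn t k N X)
      (hasSum_basisFn_mul ht0 ht1 hk 1 M N) (hasSum_basisFn_mul ht0 ht1 hk (1 - 1) M N)).mul_left
      (σ M * σ N)
    refine hasSum_of_eq h (fun m => ?_) ?_
    · rw [Function.comp_apply, hψ, hf, hf]
      ring
    · by_cases h : M = N
      · subst h
        rw [if_pos rfl, if_pos rfl, hσ]
        norm_num
      · simp [h]
  refine ⟨fun N => ofSquareSummable 𝕜 (fun x : halfIntegers => f N x) (horth N N).summable,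
    fun _ _ => rfl, not_isCompleteSystem (fun _ _ => rfl) horth ⟨0, 0, by simp⟩ h0⟩

end Completeness

end BarcodeF

/-! ### The main theorem. -/

theorem propositionA7 {𝕜 : Type*} [RCLike 𝕜] (q : ℝ) (hq0 : 0 < q) (hq1 : q < 1)
    (κ : ℂ) (hκre : κ.re = 0) (hκim : 0 < κ.im)
    (hκ : ∀ m : ℤ, ‖κ‖ ≠ q ^ ((m : ℝ) / 2)) :
    -- representation of the identity
    (∀ x ∈ BarcodeF.halfIntegers, ∀ y ∈ BarcodeF.halfIntegers, x - y ∈ BarcodeF.integers →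
      HasSum
        (fun N : ℕ => BarcodeF.F q κ N x * BarcodeF.F q κ N y /
          BarcodeF.l2Norm BarcodeF.integers (BarcodeF.F q κ N) ^ 2)
        (if x = y then 1 else 0)) ∧
    -- the normalized functions are orthonormal and complete on the integers
    (∃ e : ℕ → BarcodeF.L2 𝕜 BarcodeF.integers,
      (∀ N x, e N x = ((BarcodeF.normalizedF q κ N x : ℝ) : 𝕜)) ∧
        Orthonormal 𝕜 e ∧ BarcodeF.IsCompleteSystem 𝕜 e) ∧
    -- the same on the shifted integers
    (∃ e : ℕ → BarcodeF.L2 𝕜 BarcodeF.shiftedIntegers,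
      (∀ N x, e N x = ((BarcodeF.normalizedF q κ N x : ℝ) : 𝕜)) ∧
        Orthonormal 𝕜 e ∧ BarcodeF.IsCompleteSystem 𝕜 e) ∧
    -- on all half-integers they are square summable, but not complete
    (∃ e : ℕ → BarcodeF.L2 𝕜 BarcodeF.halfIntegers,
      (∀ N x, e N x = ((BarcodeF.normalizedF q κ N x : ℝ) : 𝕜)) ∧
        ¬ BarcodeF.IsCompleteSystem 𝕜 e) := by
  obtain ⟨t, ht0, ht1, rfl⟩ : ∃ t : ℝ, 0 < t ∧ t < 1 ∧ q = t ^ 4 := by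
    refine ⟨q ^ (1 / 4 : ℝ), Real.rpow_pos_of_pos hq0 _,
      Real.rpow_lt_one hq0.le hq1 (by norm_num), ?_⟩
    rw [← Real.rpow_natCast, ← Real.rpow_mul hq0.le]
    norm_num
  have hk : 0 < ‖κ‖ := norm_pos_iff.2 fun h => by simp [h] at hκim
  -- The excluded values of `‖κ‖` are exactly the positive zeros of this theta function.
  have hθ : BarcodeF.theta (t ^ 2) ‖κ‖ ≠ 0 := BarcodeF.theta_ne_zero ht0 ht1 hk fun m => by
    rw [← BarcodeF.pow_four_rpow ht0 (r := (m : ℝ) / 2) (by push_cast; ring)]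
    exact hκ m
  obtain ⟨σ, hσ, hf⟩ := BarcodeF.exists_normalizedF_eq ht0 ht1 hκre hκim hθ
  refine ⟨?_, BarcodeF.exists_orthonormal_complete ht0 ht1 hk hσ hf BarcodeF.exists_equiv_integers,
    BarcodeF.exists_orthonormal_complete ht0 ht1 hk hσ hf BarcodeF.exists_equiv_shiftedIntegers,
    BarcodeF.exists_not_complete ht0 ht1 hk hσ hf ?_⟩
  · intro x hx y _ hxy
    refine BarcodeF.hasSum_of_eq
      (BarcodeF.hasSum_mul_of_sub_mem_integers ht0 ht1 hk hσ hf hx hxy) (fun N => ?_) rfl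
    rw [BarcodeF.normalizedF, BarcodeF.normalizedF, div_mul_div_comm, pow_two]
  · have h0 : (0 : ℝ) ∈ BarcodeF.integers := ⟨0, by simp⟩
    have h := BarcodeF.hasSum_mul_of_mem ht0 ht1 hk hσ hf BarcodeF.exists_equiv_integers h0 h0
    rwa [if_pos rfl] at h
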